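/- For $n\ge 0$ write $(x)_n=(x;q)_n=\prod_{j=0}^{n-1}(1-xq^j)$, and $(x)_\infty=\prod_{j\ge0}(1-xq^j)=\lim_{n\to\infty}(x)_n$ when $q\in\mathbb C$, $|q|<1$. Let $T_n=n(n+1)/2$ (so $T_{-1}=0$). Let $a,b,c,d,ab,ac,ad,bc,bd,cd,Q$ denote eleven independent non-negative integer variables ($ab$ is a single variable, not the product of $a$ and $b$, and likewise for $ac,\dots,cd$), and put $\tau=a+b+c+d+ab+ac+ad+bc+bd+cd$. For integers $i,j,k,l\ge0$ the $i,j,k,l$-constraints are $$i=a+ab+ac+ad+Q,\quad j=b+ab+bc+bd+Q,\quad k=c+ac+bc+cd+Q,\quad l=d+ad+bd+cd+Q.$$ Define $$S_q(i,j,k,l)=\sum_{i,j,k,l\text{-constraints}}\frac{q^{T_\tau+T_{ab}+T_{ac}+T_{ad}+T_{bc}+T_{bd}+T_{cd}-bc-bd-cd+4T_{Q-1}+3Q+2Q\tau}}{(q)_a(q)_b(q)_c(q)_d(q)_{ab}(q)_{ac}(q)_{ad}(q)_{bc}(q)_{bd}(q)_{cd}(q)_Q}\left\{(1-q^a)+q^{a+bc+bd+Q}(1-q^b)+q^{a+bc+bd+Q+b+cd}\right\}.$$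 1. For all $i,j,k,l\ge 0$ the set of solutions of the constraints is finite, and $(a,\dots,cd,Q)\mapsto(ab,ac,ad,bc,bd,cd,Q)$ is a bijection from it onto the set of 7-tuples of non-negative integers with $ab+ac+ad+Q\le i$, $ab+bc+bd+Q\le j$, $ac+bc+cd+Q\le k$, $ad+bd+cd+Q\le l$; that is, $S_q(i,j,k,l)$ is a finite $7$-fold sum. 2. For every field $K$, every $q\in K$ with $q^n\ne1$ for all $n\ge1$ (for instance an indeterminate $q$, or $q\in\mathbb C$ with $|q|<1$), and all integers $i,j,k,l\ge0$, $$S_q(i,j,k,l)=\frac{q^{T_i+T_j+T_k+T_l}}{(q)_i(q)_j(q)_k(q)_l}.$$ 3. In generating function form: for all $q\in\mathbb C$ with $|q|<1$ and all $A,B,C,D\in\mathbb C$, the following series over $i,j,k,l\ge 0$ converges absolutely and $$\sum_{i,j,k,l\ge0}A^iB^jC^kD^l\,S_q(i,j,k,l)=(-Aq)_\infty(-Bq)_\infty(-Cq)_\infty(-Dq)_\infty .$$ 4. Setting any one of $i,j,k,l$ equal to $0$ recovers the three-parameter identity of Alladi, Andrews and Gordon for Göllnitz's theorem: let $K$ and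 $q$ be as in 2. For integers $x,y,z\ge0$ let $$G_q(x,y,z)=\sum_{\substack{x=a+ab+ac\\ y=b+ab+bc\\ z=c+ac+bc}}\frac{q^{T_s+T_{ab}+T_{ac}+T_{bc-1}}(1-q^a+q^{a+bc})}{(q)_a(q)_b(q)_c(q)_{ab}(q)_{ac}(q)_{bc}},\qquad s=a+b+c+ab+ac+bc,$$ the sum being over non-negative integers $a,b,c,ab,ac,bc$. Then $$S_q(0,x,y,z)=S_q(x,0,y,z)=S_q(x,y,0,z)=S_q(x,y,z,0)=G_q(x,y,z),$$ in each of the four cases the right-hand side of the identity in 2 becomes $q^{T_x+T_y+T_z}/((q)_x(q)_y(q)_z)$, and consequently $$G_q(x,y,z)=\frac{q^{T_x+T_y+T_z}}{(q)_x(q)_y(q)_z}.$$ -/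

import Mathlib

/-- The `q`-shifted factorial `(a)_n = (a; q)_n = ∏_{j=0}^{n-1} (1 - a q^j)`, for `n ≥ 0`. -/
def qPoch {R : Type*} [CommRing R] (a q : R) (n : ℕ) : R :=
  ∏ j ∈ Finset.range n, (1 - a * q ^ j)

/-- `(a)_∞ = (a; q)_∞ = ∏_{j ≥ 0} (1 - a q^j)`. -/
noncomputable def qPochInf (a q : ℂ) : ℂ := ∏' j : ℕ, (1 - a * q ^ j)

/-- For `|q| < 1` the infinite product `(a)_∞` is the limit of the finite ones. -/
theorem tendsto_qPoch (a q : ℂ) (hq : ‖q‖ < 1) :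
    Filter.Tendsto (fun n => qPoch a q n) Filter.atTop (nhds (qPochInf a q)) := by
  have hs : Summable (fun j : ℕ => ‖-(a * q ^ j)‖) := by
    simp only [norm_neg, norm_mul, norm_pow]
    exact (summable_geometric_of_lt_one (norm_nonneg q) hq).mul_left _
  have hm := (multipliable_one_add_of_summable hs).tendsto_prod_tprod_nat
  simpa only [qPoch, qPochInf, sub_eq_add_neg] using hm

/-- The `n`-th triangular number `T_n = n (n + 1) / 2`. -/
def tri (n : ℕ) : ℕ := n * (n + 1) / 2

theorem two_mul_tri (n : ℕ) : 2 * (tri n : ℤ) = n * (n + 1) := by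
  have h : 2 * tri n = n * (n + 1) := Nat.mul_div_cancel' (Nat.even_mul_succ_self n).two_dvd
  exact_mod_cast h

theorem le_tri (n : ℕ) : n ≤ tri n := by
  have h := two_mul_tri n
  zify
  rcases n.eq_zero_or_pos with rfl | hn
  · simp [tri]
  · have : (1 : ℤ) ≤ n := by exact_mod_cast hn
    nlinarith

/-! ### The four-parameter sum -/

/-- The summation variables `a, b, c, d, ab, ac, ad, bc, bd, cd, Q`: eleven independent
non-negative integers (`ab` is a single variable, not a product). -/
@[ext]
structure Vars4 where
  a : ℕ
  b : ℕ
  c : ℕ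
  d : ℕ
  ab : ℕ
  ac : ℕ
  ad : ℕ
  bc : ℕ
  bd : ℕ
  cd : ℕ
  Q : ℕ

namespace Vars4

/-- `τ = a + b + c + d + ab + ac + ad + bc + bd + cd`. -/
def tau (v : Vars4) : ℕ :=
  v.a + v.b + v.c + v.d + v.ab + v.ac + v.ad + v.bc + v.bd + v.cd

/-- The `i, j, k, l`-constraints. -/
def constraints (i j k l : ℕ) : Set Vars4 :=
  {v | i = v.a + v.ab + v.ac + v.ad + v.Q ∧
       j = v.b + v.ab + v.bc + v.bd + v.Q ∧
       k = v.c + v.ac + v.bc + v.cd + v.Q ∧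
       l = v.d + v.ad + v.bd + v.cd + v.Q}

/-- The seven variables `ab, ac, ad, bc, bd, cd, Q`. -/
def free (v : Vars4) : ℕ × ℕ × ℕ × ℕ × ℕ × ℕ × ℕ :=
  (v.ab, v.ac, v.ad, v.bc, v.bd, v.cd, v.Q)

theorem free_injOn (i j k l : ℕ) : Set.InjOn free (constraints i j k l) := by
  rintro ⟨⟩ ⟨h1, h2, h3, h4⟩ ⟨⟩ ⟨h5, h6, h7, h8⟩ h
  simp only [free, Prod.mk.injEq] at h h1 h2 h3 h4 h5 h6 h7 h8
  simp only [Vars4.mk.injEq]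
  omega

theorem constraints_finite (i j k l : ℕ) : (constraints i j k l).Finite := by
  refine Set.Finite.of_finite_image ?_ (free_injOn i j k l)
  refine (((Set.finite_Iic i).prod ((Set.finite_Iic i).prod ((Set.finite_Iic i).prod
    ((Set.finite_Iic j).prod ((Set.finite_Iic j).prod ((Set.finite_Iic k).prod
    (Set.finite_Iic i)))))))).subset ?_
  rintro _ ⟨v, ⟨h1, h2, h3, h4⟩, rfl⟩
  simp only [free, Set.mem_prod, Set.mem_Iic]
  omega

/-- The exponent
`T_τ + T_{ab} + T_{ac} + T_{ad} + T_{bc} + T_{bd} + T_{cd} - bc - bd - cd + 4 T_{Q-1} + 3Q + 2Qτ`.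
No truncation occurs, since `n ≤ T_n`; and `T_{Q-1} = 0` for `Q = 0`, as `T_{-1} = 0`.
See `expo_cast`. -/
def expo (v : Vars4) : ℕ :=
  (tri v.tau + tri v.ab + tri v.ac + tri v.ad + tri v.bc + tri v.bd + tri v.cd
    - v.bc - v.bd - v.cd) + 4 * tri (v.Q - 1) + 3 * v.Q + 2 * v.Q * v.tau

/-- `expo` agrees with the same expression over the integers, where
`4 T_{Q-1} = 2 (Q - 1) Q`. -/
theorem expo_cast (v : Vars4) :
    (v.expo : ℤ) = tri v.tau + tri v.ab + tri v.ac + tri v.ad + tri v.bc + tri v.bd + tri v.cd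
      - v.bc - v.bd - v.cd + 2 * ((v.Q : ℤ) - 1) * v.Q + 3 * v.Q + 2 * v.Q * v.tau := by
  have h1 := le_tri v.bc
  have h2 := le_tri v.bd
  have h3 := le_tri v.cd
  have h4 : (4 * tri (v.Q - 1) : ℤ) = 2 * ((v.Q : ℤ) - 1) * v.Q := by
    rcases Nat.eq_zero_or_pos v.Q with h | h
    · simp [h, tri]
    · have h5 := two_mul_tri (v.Q - 1)
      rw [Nat.cast_sub h] at h5
      push_cast at h5
      linear_combination 2 * h5
  rw [← h4]
  unfold expo
  rw [Nat.sub_sub, Nat.sub_sub]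
  push_cast [Nat.cast_sub (show v.bc + (v.bd + v.cd) ≤ tri v.tau + tri v.ab + tri v.ac +
    tri v.ad + tri v.bc + tri v.bd + tri v.cd by omega)]
  ring

/-- The summand of the four-parameter identity; here `(q)_n = (q; q)_n`. -/
noncomputable def summand {K : Type*} [Field K] (q : K) (v : Vars4) : K :=
  q ^ v.expo /
      (qPoch q q v.a * qPoch q q v.b * qPoch q q v.c * qPoch q q v.d *
        qPoch q q v.ab * qPoch q q v.ac * qPoch q q v.ad *
        qPoch q q v.bc * qPoch q q v.bd * qPoch q q v.cd * qPoch q q v.Q) *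
    ((1 - q ^ v.a) + q ^ (v.a + v.bc + v.bd + v.Q) * (1 - q ^ v.b)
      + q ^ (v.a + v.bc + v.bd + v.Q + v.b + v.cd))

end Vars4

/-- The sum of the summand over the (finitely many) variables satisfying the
`i, j, k, l`-constraints. -/
noncomputable def keySum {K : Type*} [Field K] (q : K) (i j k l : ℕ) : K :=
  ∑ v ∈ (Vars4.constraints_finite i j k l).toFinset, v.summand q

/-- `q^{T_i + T_j + T_k + T_l} / ((q)_i (q)_j (q)_k (q)_l)`. -/
noncomputable def keyRhs {K : Type*} [Field K] (q : K) (i j k l : ℕ) : K :=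
  q ^ (tri i + tri j + tri k + tri l) /
    (qPoch q q i * qPoch q q j * qPoch q q k * qPoch q q l)

/-! ### The three-parameter (Göllnitz) sum -/

/-- The summation variables `a, b, c, ab, ac, bc`. -/
@[ext]
structure Vars3 where
  a : ℕ
  b : ℕ
  c : ℕ
  ab : ℕ
  ac : ℕ
  bc : ℕ

namespace Vars3

/-- `s = a + b + c + ab + ac + bc`. -/
def s (v : Vars3) : ℕ := v.a + v.b + v.c + v.ab + v.ac + v.bc

/-- The `i, j, k`-constraints. -/
def constraints (i j k : ℕ) : Set Vars3 :=
  {v | i = v.a + v.ab + v.ac ∧ j = v.b + v.ab + v.bc ∧ k = v.c + v.ac + v.bc}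

theorem constraints_finite (i j k : ℕ) : (constraints i j k).Finite := by
  have hinj : Set.InjOn (fun v : Vars3 => (v.ab, v.ac, v.bc)) (constraints i j k) := by
    rintro ⟨⟩ ⟨h1, h2, h3⟩ ⟨⟩ ⟨h5, h6, h7⟩ h
    simp only [Prod.mk.injEq] at h h1 h2 h3 h5 h6 h7
    simp only [Vars3.mk.injEq]
    omega
  refine Set.Finite.of_finite_image ?_ hinj
  refine ((Set.finite_Iic i).prod ((Set.finite_Iic i).prod (Set.finite_Iic j))).subset ?_
  rintro _ ⟨v, ⟨h1, h2, h3⟩, rfl⟩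
  simp only [Set.mem_prod, Set.mem_Iic]
  omega

/-- The summand
`q^{T_s + T_{ab} + T_{ac} + T_{bc-1}} (1 - q^a + q^{a+bc}) / ((q)_a (q)_b ⋯ (q)_{bc})`
(for `bc = 0` one has `T_{bc-1} = T_{-1} = 0`, which is also the value of `tri (0 - 1)`). -/
noncomputable def summand {K : Type*} [Field K] (q : K) (v : Vars3) : K :=
  q ^ (tri v.s + tri v.ab + tri v.ac + tri (v.bc - 1)) * (1 - q ^ v.a + q ^ (v.a + v.bc)) /
    (qPoch q q v.a * qPoch q q v.b * qPoch q q v.c *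
      qPoch q q v.ab * qPoch q q v.ac * qPoch q q v.bc)

end Vars3

/-- The left-hand side of the three-parameter identity. -/
noncomputable def gollnitzSum {K : Type*} [Field K] (q : K) (i j k : ℕ) : K :=
  ∑ v ∈ (Vars3.constraints_finite i j k).toFinset, v.summand q

/-- The right-hand side of the three-parameter identity,
`q^{T_i + T_j + T_k} / ((q)_i (q)_j (q)_k)`. -/
noncomputable def gollnitzRhs {K : Type*} [Field K] (q : K) (i j k : ℕ) : K :=
  q ^ (tri i + tri j + tri k) / (qPoch q q i * qPoch q q j * qPoch q q k)

/-! Since `4 T_{Q-1} + 3Q = 2Q² + Q`, the terms in `τ` and `Q` combine to `T_t` with `t = τ + 2Q`.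
That is the only quadratic coupling between the variables. Replace `q^{T_t}` by `z^t`: the
generating series in `A, B, C, D` over `K[z]` then factors formally into eleven Euler products,
namely `1/(zA)_∞` and its analogues for `b, c, d`; `(-zABq)_∞`, and likewise for `ac, ad`;
`(-zBC)_∞`, and likewise for `bd, cd`; and `1/(z²ABCD)_∞`. A weight `q^f` with `f` linear only
shifts their arguments by powers of `q`, so every series that occurs is a polynomial multiple of a
single one, and relations among them are polynomial identities.

One such relation is `one_add_mul_braceSeries`. Under the linear map `z^t ↦ q^{T_t}`, multiplication
by `z` becomes the weight `q^{t+1}`, and two of its terms cancel. With `F` the generating function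
of `keySum`, what remains is `(1 + Aq) F(Aq) = F(A)`, that is, `(1 - q^{i+1}) S(i+1,j,k,l) = q^{i+1}
S(i,j,k,l)` (`keySum_succ`).

This lowers only the first parameter. Setting any parameter to zero gives the same three-parameter
sum, however, so `S(0,j,k,l) = S(j,k,l,0)`. Rotating four times ends at `S(0,0,0,0) = 1`. The
generating function form follows from Euler's expansion of `(-xq)_∞`. -/

theorem qPoch_zero {R : Type*} [CommRing R] (a q : R) : qPoch a q 0 = 1 :=
  Finset.prod_range_zero _

theorem tri_zero : tri 0 = 0 := rfl

theorem tri_succ (n : ℕ) : tri (n + 1) = tri n + (n + 1) := by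
  have h1 := two_mul_tri n
  have h2 := two_mul_tri (n + 1)
  zify
  push_cast at h2
  linarith

theorem qPoch_succ {R : Type*} [CommRing R] (a q : R) (n : ℕ) :
    qPoch a q (n + 1) = qPoch a q n * (1 - a * q ^ n) :=
  Finset.prod_range_succ _ _

theorem qPoch_self_succ {R : Type*} [CommRing R] (q : R) (n : ℕ) :
    qPoch q q (n + 1) = qPoch q q n * (1 - q ^ (n + 1)) := by
  rw [qPoch_succ, pow_succ']

theorem one_sub_pow_ne_zero {K : Type*} [Field K] {q : K} (hq : ∀ n : ℕ, 1 ≤ n → q ^ n ≠ 1)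
    (n : ℕ) : 1 - q ^ (n + 1) ≠ 0 :=
  sub_ne_zero.2 (hq (n + 1) (by omega)).symm

theorem qPoch_self_ne_zero {K : Type*} [Field K] {q : K} (hq : ∀ n : ℕ, 1 ≤ n → q ^ n ≠ 1)
    (n : ℕ) : qPoch q q n ≠ 0 := by
  induction n with
  | zero => simp [qPoch]
  | succ n ih => rw [qPoch_self_succ]; exact mul_ne_zero ih (one_sub_pow_ne_zero hq n)

namespace Vars4

open Polynomial

/-! ### Generating series of weights on `Vars4` -/

/-- The exponent vector `(i, j, k, l)` attached to the variables. -/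
noncomputable def deg (v : Vars4) : Fin 4 →₀ ℕ :=
  Finsupp.single 0 (v.a + v.ab + v.ac + v.ad + v.Q) +
  Finsupp.single 1 (v.b + v.ab + v.bc + v.bd + v.Q) +
  Finsupp.single 2 (v.c + v.ac + v.bc + v.cd + v.Q) +
  Finsupp.single 3 (v.d + v.ad + v.bd + v.cd + v.Q)

theorem deg_eq_iff (v : Vars4) (n : Fin 4 →₀ ℕ) :
    v.deg = n ↔ v ∈ constraints (n 0) (n 1) (n 2) (n 3) := by
  rw [Finsupp.ext_iff]
  simp [Fin.forall_fin_succ, deg, constraints, Finsupp.single_apply, eq_comm]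

/-- The power series in four variables whose coefficient at `n` is the sum of `w` over all
variables with exponent vector `n`. -/
noncomputable def genSeries {R : Type*} [CommRing R] (w : Vars4 → R) : MvPowerSeries (Fin 4) R :=
  fun n => ∑ v ∈ (constraints_finite (n 0) (n 1) (n 2) (n 3)).toFinset, w v

theorem coeff_genSeries {R : Type*} [CommRing R] (w : Vars4 → R) (n : Fin 4 →₀ ℕ) :
    MvPowerSeries.coeff n (genSeries w) =
      ∑ v ∈ (constraints_finite (n 0) (n 1) (n 2) (n 3)).toFinset, w v := rfl

theorem genSeries_sub {R : Type*} [CommRing R] (w w' : Vars4 → R) :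
    genSeries (fun v => w v - w' v) = genSeries w - genSeries w' := by
  ext n; simp [coeff_genSeries, Finset.sum_sub_distrib]

/-- Reindexing along the injection `s`: terms outside its range vanish, and `s` raises every
exponent vector by the same `m`. -/
theorem genSeries_of_shift {R : Type*} [CommRing R] {s : Vars4 → Vars4} (hs : s.Injective)
    {m : Fin 4 →₀ ℕ} (hm : ∀ v, (s v).deg = v.deg + m) {w w' : Vars4 → R} {r : R}
    (h0 : ∀ v, v ∉ Set.range s → w v = 0) (hw : ∀ v, w (s v) = r * w' v) :
    genSeries w = MvPowerSeries.monomial m r * genSeries w' := by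
  ext n
  rw [MvPowerSeries.coeff_monomial_mul, coeff_genSeries, coeff_genSeries]
  split_ifs with hmn
  · rw [Finset.mul_sum]
    symm
    apply Finset.sum_of_injOn s hs.injOn
    · intro v hv
      simp only [Set.Finite.coe_toFinset, ← deg_eq_iff] at hv ⊢
      rw [hm, hv, tsub_add_cancel_of_le hmn]
    · intro v hv hv'
      apply h0
      rintro ⟨u, rfl⟩
      apply hv'
      refine ⟨u, ?_, rfl⟩
      simp only [Set.Finite.mem_toFinset, ← deg_eq_iff] at hv
      simp only [Set.Finite.coe_toFinset, ← deg_eq_iff]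
      rw [← hv, hm, add_tsub_cancel_right]
    · intro v _
      exact (hw v).symm
  · apply Finset.sum_eq_zero
    intro v hv
    apply h0
    rintro ⟨u, rfl⟩
    simp only [Set.Finite.mem_toFinset, ← deg_eq_iff] at hv
    rw [hm] at hv
    exact hmn (hv ▸ le_add_self)

variable {K : Type*} [Field K]

/-- `τ + 2 Q`, the quantity whose triangular number occurs in the exponent. -/
def level (v : Vars4) : ℕ := v.tau + 2 * v.Q

/-- The part of the summand without the triangular number of `level` and the last factor. -/
noncomputable def coef (q : K) (v : Vars4) : K :=
  1 / qPoch q q v.a * (1 / qPoch q q v.b) * (1 / qPoch q q v.c) * (1 / qPoch q q v.d) *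
    (q ^ tri v.ab / qPoch q q v.ab) * (q ^ tri v.ac / qPoch q q v.ac) *
    (q ^ tri v.ad / qPoch q q v.ad) *
    (q ^ (tri v.bc - v.bc) / qPoch q q v.bc) * (q ^ (tri v.bd - v.bd) / qPoch q q v.bd) *
    (q ^ (tri v.cd - v.cd) / qPoch q q v.cd) * (1 / qPoch q q v.Q)

/-- The weight `q ^ f · coef · z ^ level`. -/
noncomputable def weight (q : K) (f : Vars4 → ℕ) (v : Vars4) : K[X] :=
  C (q ^ f v * coef q v) * X ^ v.level

/-- The generating series of `weight q f`. -/
noncomputable def weightSeries (q : K) (f : Vars4 → ℕ) : MvPowerSeries (Fin 4) K[X] :=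
  genSeries (weight q f)

/-- The auxiliary variable marking `level`. -/
noncomputable def zVar (K : Type*) [Field K] : MvPowerSeries (Fin 4) K[X] := MvPowerSeries.C X

/-- The constant series `q`. -/
noncomputable def qConst (q : K) : MvPowerSeries (Fin 4) K[X] := MvPowerSeries.C (C q)

/-! ### One-step `q`-difference equations for the eleven Euler factors -/

theorem one_div_qPoch_succ {q : K} (hq : ∀ n : ℕ, 1 ≤ n → q ^ n ≠ 1) (n : ℕ) :
    1 / qPoch q q n = (1 - q ^ (n + 1)) * (1 / qPoch q q (n + 1)) := by
  have h1 := one_sub_pow_ne_zero hq n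
  have h2 := qPoch_self_ne_zero hq n
  rw [qPoch_self_succ]
  field_simp

theorem pow_tri_div_qPoch_succ {q : K} (hq : ∀ n : ℕ, 1 ≤ n → q ^ n ≠ 1) (n : ℕ) :
    q ^ (n + 1) * (q ^ tri n / qPoch q q n) =
      (1 - q ^ (n + 1)) * (q ^ tri (n + 1) / qPoch q q (n + 1)) := by
  have h1 := one_sub_pow_ne_zero hq n
  have h2 := qPoch_self_ne_zero hq n
  rw [qPoch_self_succ, tri_succ]
  field_simp
  ring

theorem pow_tri_sub_div_qPoch_succ {q : K} (hq : ∀ n : ℕ, 1 ≤ n → q ^ n ≠ 1) (n : ℕ) :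
    q ^ n * (q ^ (tri n - n) / qPoch q q n) =
      (1 - q ^ (n + 1)) * (q ^ (tri (n + 1) - (n + 1)) / qPoch q q (n + 1)) := by
  have h1 := one_sub_pow_ne_zero hq n
  have h2 := qPoch_self_ne_zero hq n
  have h3 := le_tri n
  have h4 : tri (n + 1) - (n + 1) = (tri n - n) + n := by rw [tri_succ]; omega
  rw [qPoch_self_succ, h4]
  field_simp
  ring

/-- Removing one unit of a summation variable `x` (encoded by the map `s` adding one unit). -/
theorem weightSeries_sub {q : K} {s : Vars4 → Vars4} (hs : s.Injective) {x : Vars4 → ℕ}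
    (hx : ∀ v, x v ≠ 0 → v ∈ Set.range s)
    {m : Fin 4 →₀ ℕ} (hm : ∀ v, (s v).deg = v.deg + m) {e : ℕ}
    (he : ∀ v, (s v).level = v.level + e)
    {f g : Vars4 → ℕ} {r : ℕ}
    (hc : ∀ v, q ^ f (s v) * ((1 - q ^ x (s v)) * coef q (s v)) = q ^ r * (q ^ g v * coef q v)) :
    weightSeries q f - weightSeries q (fun v => f v + x v) =
      zVar K ^ e * qConst q ^ r * MvPowerSeries.monomial m 1 * weightSeries q g := by
  have h : zVar K ^ e * qConst q ^ r * MvPowerSeries.monomial m 1 =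
      MvPowerSeries.monomial m (X ^ e * C q ^ r) := by
    rw [zVar, qConst, ← map_pow, ← map_pow, ← map_mul, ← MvPowerSeries.smul_eq_C_mul,
      ← map_smul, smul_eq_mul, mul_one]
  rw [h, weightSeries, weightSeries, weightSeries, ← genSeries_sub]
  refine genSeries_of_shift hs hm (fun v hv => ?_) (fun v => ?_)
  · have : x v = 0 := by by_contra h; exact hv (hx v h)
    simp [weight, this]
  · have h1 := congrArg (fun y => C y * (X : K[X]) ^ (v.level + e)) (hc v)
    simp only [weight, he]
    simp only [map_mul, map_sub, map_one, map_pow] at h1 ⊢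
    linear_combination h1

/-- With `x = z q^r A`, this is `F(x) - F(xq) = x F(x)` for `F(x) = 1/(x)_∞`; `r` is the slope of
`f` in this variable. The same equation governs `b`, `c`, `d`. -/
theorem weightSeries_sub_a {q : K} (hq : ∀ n : ℕ, 1 ≤ n → q ^ n ≠ 1) {f g : Vars4 → ℕ} {r : ℕ}
    (hf : ∀ v : Vars4, f { v with a := v.a + 1 } = f v + r) (hg : ∀ v, g v = f v + v.a) :
    weightSeries q f - weightSeries q g =
      zVar K * qConst q ^ r * (MvPowerSeries.X 0) * weightSeries q f := by
  obtain rfl : g = fun v => f v + v.a := funext hg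
  have h := weightSeries_sub (q := q) (s := fun v => { v with a := v.a + 1 }) (x := a)
    (m := Finsupp.single 0 1) (e := 1)
    (f := f) (g := f) (r := r)
    (fun u v h => by
      cases u; cases v
      simpa using h)
    (fun v hv => ⟨{ v with a := v.a - 1 }, by
      ext <;> simp
      omega⟩)
    (fun v => by simp only [deg, Finsupp.single_add]; abel)
    (fun v => by simp only [level, tau]; ring)
    (fun v => by
      -- As `(q)_0 = 1`, setting the variable to zero in `coef` leaves exactly the other ten
      -- factors.
      linear_combination (norm := skip) -q ^ (f v + r) * coef q { v with a := 0 } *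
        one_div_qPoch_succ hq v.a
      simp only [coef, hf, qPoch_zero]
      ring)
  rw [h]
  simp only [MvPowerSeries.X, pow_one]

theorem weightSeries_sub_b {q : K} (hq : ∀ n : ℕ, 1 ≤ n → q ^ n ≠ 1) {f g : Vars4 → ℕ} {r : ℕ}
    (hf : ∀ v : Vars4, f { v with b := v.b + 1 } = f v + r) (hg : ∀ v, g v = f v + v.b) :
    weightSeries q f - weightSeries q g =
      zVar K * qConst q ^ r * (MvPowerSeries.X 1) * weightSeries q f := by
  obtain rfl : g = fun v => f v + v.b := funext hg
  have h := weightSeries_sub (q := q) (s := fun v => { v with b := v.b + 1 }) (x := b)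
    (m := Finsupp.single 1 1) (e := 1)
    (f := f) (g := f) (r := r)
    (fun u v h => by
      cases u; cases v
      simpa using h)
    (fun v hv => ⟨{ v with b := v.b - 1 }, by
      ext <;> simp
      omega⟩)
    (fun v => by simp only [deg, Finsupp.single_add]; abel)
    (fun v => by simp only [level, tau]; ring)
    (fun v => by
      linear_combination (norm := skip) -q ^ (f v + r) * coef q { v with b := 0 } *
        one_div_qPoch_succ hq v.b
      simp only [coef, hf, qPoch_zero]
      ring)
  rw [h]
  simp only [MvPowerSeries.X, pow_one]

theorem weightSeries_sub_c {q : K} (hq : ∀ n : ℕ, 1 ≤ n → q ^ n ≠ 1) {f g : Vars4 → ℕ} {r : ℕ}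
    (hf : ∀ v : Vars4, f { v with c := v.c + 1 } = f v + r) (hg : ∀ v, g v = f v + v.c) :
    weightSeries q f - weightSeries q g =
      zVar K * qConst q ^ r * (MvPowerSeries.X 2) * weightSeries q f := by
  obtain rfl : g = fun v => f v + v.c := funext hg
  have h := weightSeries_sub (q := q) (s := fun v => { v with c := v.c + 1 }) (x := c)
    (m := Finsupp.single 2 1) (e := 1)
    (f := f) (g := f) (r := r)
    (fun u v h => by
      cases u; cases v
      simpa using h)
    (fun v hv => ⟨{ v with c := v.c - 1 }, by
      ext <;> simp
      omega⟩)
    (fun v => by simp only [deg, Finsupp.single_add]; abel)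
    (fun v => by simp only [level, tau]; ring)
    (fun v => by
      linear_combination (norm := skip) -q ^ (f v + r) * coef q { v with c := 0 } *
        one_div_qPoch_succ hq v.c
      simp only [coef, hf, qPoch_zero]
      ring)
  rw [h]
  simp only [MvPowerSeries.X, pow_one]

theorem weightSeries_sub_d {q : K} (hq : ∀ n : ℕ, 1 ≤ n → q ^ n ≠ 1) {f g : Vars4 → ℕ} {r : ℕ}
    (hf : ∀ v : Vars4, f { v with d := v.d + 1 } = f v + r) (hg : ∀ v, g v = f v + v.d) :
    weightSeries q f - weightSeries q g =
      zVar K * qConst q ^ r * (MvPowerSeries.X 3) * weightSeries q f := by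
  obtain rfl : g = fun v => f v + v.d := funext hg
  have h := weightSeries_sub (q := q) (s := fun v => { v with d := v.d + 1 }) (x := d)
    (m := Finsupp.single 3 1) (e := 1)
    (f := f) (g := f) (r := r)
    (fun u v h => by
      cases u; cases v
      simpa using h)
    (fun v hv => ⟨{ v with d := v.d - 1 }, by
      ext <;> simp
      omega⟩)
    (fun v => by simp only [deg, Finsupp.single_add]; abel)
    (fun v => by simp only [level, tau]; ring)
    (fun v => by
      linear_combination (norm := skip) -q ^ (f v + r) * coef q { v with d := 0 } *
        one_div_qPoch_succ hq v.d
      simp only [coef, hf, qPoch_zero]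
      ring)
  rw [h]
  simp only [MvPowerSeries.X, pow_one]

/-- With `x = z q^r AB`, this is `F(x) - F(xq) = xq F(xq)` for `F(x) = (-xq)_∞`. The same equation
governs `ac`, `ad`. -/
theorem weightSeries_sub_ab {q : K} (hq : ∀ n : ℕ, 1 ≤ n → q ^ n ≠ 1) {f g : Vars4 → ℕ} {r : ℕ}
    (hf : ∀ v : Vars4, f { v with ab := v.ab + 1 } = f v + r) (hg : ∀ v, g v = f v + v.ab) :
    weightSeries q f - weightSeries q g =
      zVar K * qConst q ^ (r + 1) * (MvPowerSeries.X 0 * MvPowerSeries.X 1) * weightSeries q g := by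
  obtain rfl : g = fun v => f v + v.ab := funext hg
  have h := weightSeries_sub (q := q) (s := fun v => { v with ab := v.ab + 1 }) (x := ab)
    (m := Finsupp.single 0 1 + Finsupp.single 1 1) (e := 1)
    (f := f) (g := fun v => f v + v.ab) (r := r + 1)
    (fun u v h => by
      cases u; cases v
      simpa using h)
    (fun v hv => ⟨{ v with ab := v.ab - 1 }, by
      ext <;> simp
      omega⟩)
    (fun v => by simp only [deg, Finsupp.single_add]; abel)
    (fun v => by simp only [level, tau]; ring)
    (fun v => by
      linear_combination (norm := skip) -q ^ (f v + r) * coef q { v with ab := 0 } *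
        pow_tri_div_qPoch_succ hq v.ab
      simp only [coef, hf, tri_zero, qPoch_zero]
      ring)
  rw [h]
  simp only [MvPowerSeries.X, MvPowerSeries.monomial_mul_monomial, mul_one, pow_one]

theorem weightSeries_sub_ac {q : K} (hq : ∀ n : ℕ, 1 ≤ n → q ^ n ≠ 1) {f g : Vars4 → ℕ} {r : ℕ}
    (hf : ∀ v : Vars4, f { v with ac := v.ac + 1 } = f v + r) (hg : ∀ v, g v = f v + v.ac) :
    weightSeries q f - weightSeries q g =
      zVar K * qConst q ^ (r + 1) * (MvPowerSeries.X 0 * MvPowerSeries.X 2) * weightSeries q g := by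
  obtain rfl : g = fun v => f v + v.ac := funext hg
  have h := weightSeries_sub (q := q) (s := fun v => { v with ac := v.ac + 1 }) (x := ac)
    (m := Finsupp.single 0 1 + Finsupp.single 2 1) (e := 1)
    (f := f) (g := fun v => f v + v.ac) (r := r + 1)
    (fun u v h => by
      cases u; cases v
      simpa using h)
    (fun v hv => ⟨{ v with ac := v.ac - 1 }, by
      ext <;> simp
      omega⟩)
    (fun v => by simp only [deg, Finsupp.single_add]; abel)
    (fun v => by simp only [level, tau]; ring)
    (fun v => by
      linear_combination (norm := skip) -q ^ (f v + r) * coef q { v with ac := 0 } *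
        pow_tri_div_qPoch_succ hq v.ac
      simp only [coef, hf, tri_zero, qPoch_zero]
      ring)
  rw [h]
  simp only [MvPowerSeries.X, MvPowerSeries.monomial_mul_monomial, mul_one, pow_one]

theorem weightSeries_sub_ad {q : K} (hq : ∀ n : ℕ, 1 ≤ n → q ^ n ≠ 1) {f g : Vars4 → ℕ} {r : ℕ}
    (hf : ∀ v : Vars4, f { v with ad := v.ad + 1 } = f v + r) (hg : ∀ v, g v = f v + v.ad) :
    weightSeries q f - weightSeries q g =
      zVar K * qConst q ^ (r + 1) * (MvPowerSeries.X 0 * MvPowerSeries.X 3) * weightSeries q g := by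
  obtain rfl : g = fun v => f v + v.ad := funext hg
  have h := weightSeries_sub (q := q) (s := fun v => { v with ad := v.ad + 1 }) (x := ad)
    (m := Finsupp.single 0 1 + Finsupp.single 3 1) (e := 1)
    (f := f) (g := fun v => f v + v.ad) (r := r + 1)
    (fun u v h => by
      cases u; cases v
      simpa using h)
    (fun v hv => ⟨{ v with ad := v.ad - 1 }, by
      ext <;> simp
      omega⟩)
    (fun v => by simp only [deg, Finsupp.single_add]; abel)
    (fun v => by simp only [level, tau]; ring)
    (fun v => by
      linear_combination (norm := skip) -q ^ (f v + r) * coef q { v with ad := 0 } *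
        pow_tri_div_qPoch_succ hq v.ad
      simp only [coef, hf, tri_zero, qPoch_zero]
      ring)
  rw [h]
  simp only [MvPowerSeries.X, MvPowerSeries.monomial_mul_monomial, mul_one, pow_one]

/-- The exponent is `T_n - n = T_{n-1}`, so the factor is `F(x) = (-x)_∞` and `F(x) - F(xq) = x
F(xq)`, with no extra `q`. The same equation governs `bd`, `cd`. -/
theorem weightSeries_sub_bc {q : K} (hq : ∀ n : ℕ, 1 ≤ n → q ^ n ≠ 1) {f g : Vars4 → ℕ} {r : ℕ}
    (hf : ∀ v : Vars4, f { v with bc := v.bc + 1 } = f v + r) (hg : ∀ v, g v = f v + v.bc) :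
    weightSeries q f - weightSeries q g =
      zVar K * qConst q ^ r * (MvPowerSeries.X 1 * MvPowerSeries.X 2) * weightSeries q g := by
  obtain rfl : g = fun v => f v + v.bc := funext hg
  have h := weightSeries_sub (q := q) (s := fun v => { v with bc := v.bc + 1 }) (x := bc)
    (m := Finsupp.single 1 1 + Finsupp.single 2 1) (e := 1)
    (f := f) (g := fun v => f v + v.bc) (r := r)
    (fun u v h => by
      cases u; cases v
      simpa using h)
    (fun v hv => ⟨{ v with bc := v.bc - 1 }, by
      ext <;> simp
      omega⟩)
    (fun v => by simp only [deg, Finsupp.single_add]; abel)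
    (fun v => by simp only [level, tau]; ring)
    (fun v => by
      linear_combination (norm := skip) -q ^ (f v + r) * coef q { v with bc := 0 } *
        pow_tri_sub_div_qPoch_succ hq v.bc
      simp only [coef, hf, tri_zero, qPoch_zero]
      ring)
  rw [h]
  simp only [MvPowerSeries.X, MvPowerSeries.monomial_mul_monomial, mul_one, pow_one]

theorem weightSeries_sub_bd {q : K} (hq : ∀ n : ℕ, 1 ≤ n → q ^ n ≠ 1) {f g : Vars4 → ℕ} {r : ℕ}
    (hf : ∀ v : Vars4, f { v with bd := v.bd + 1 } = f v + r) (hg : ∀ v, g v = f v + v.bd) :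
    weightSeries q f - weightSeries q g =
      zVar K * qConst q ^ r * (MvPowerSeries.X 1 * MvPowerSeries.X 3) * weightSeries q g := by
  obtain rfl : g = fun v => f v + v.bd := funext hg
  have h := weightSeries_sub (q := q) (s := fun v => { v with bd := v.bd + 1 }) (x := bd)
    (m := Finsupp.single 1 1 + Finsupp.single 3 1) (e := 1)
    (f := f) (g := fun v => f v + v.bd) (r := r)
    (fun u v h => by
      cases u; cases v
      simpa using h)
    (fun v hv => ⟨{ v with bd := v.bd - 1 }, by
      ext <;> simp
      omega⟩)
    (fun v => by simp only [deg, Finsupp.single_add]; abel)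
    (fun v => by simp only [level, tau]; ring)
    (fun v => by
      linear_combination (norm := skip) -q ^ (f v + r) * coef q { v with bd := 0 } *
        pow_tri_sub_div_qPoch_succ hq v.bd
      simp only [coef, hf, tri_zero, qPoch_zero]
      ring)
  rw [h]
  simp only [MvPowerSeries.X, MvPowerSeries.monomial_mul_monomial, mul_one, pow_one]

theorem weightSeries_sub_cd {q : K} (hq : ∀ n : ℕ, 1 ≤ n → q ^ n ≠ 1) {f g : Vars4 → ℕ} {r : ℕ}
    (hf : ∀ v : Vars4, f { v with cd := v.cd + 1 } = f v + r) (hg : ∀ v, g v = f v + v.cd) :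
    weightSeries q f - weightSeries q g =
      zVar K * qConst q ^ r * (MvPowerSeries.X 2 * MvPowerSeries.X 3) * weightSeries q g := by
  obtain rfl : g = fun v => f v + v.cd := funext hg
  have h := weightSeries_sub (q := q) (s := fun v => { v with cd := v.cd + 1 }) (x := cd)
    (m := Finsupp.single 2 1 + Finsupp.single 3 1) (e := 1)
    (f := f) (g := fun v => f v + v.cd) (r := r)
    (fun u v h => by
      cases u; cases v
      simpa using h)
    (fun v hv => ⟨{ v with cd := v.cd - 1 }, by
      ext <;> simp
      omega⟩)
    (fun v => by simp only [deg, Finsupp.single_add]; abel)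
    (fun v => by simp only [level, tau]; ring)
    (fun v => by
      linear_combination (norm := skip) -q ^ (f v + r) * coef q { v with cd := 0 } *
        pow_tri_sub_div_qPoch_succ hq v.cd
      simp only [coef, hf, tri_zero, qPoch_zero]
      ring)
  rw [h]
  simp only [MvPowerSeries.X, MvPowerSeries.monomial_mul_monomial, mul_one, pow_one]

/-- Again a factor `1/(x)_∞`, now with `x = z² q^r ABCD`: one unit of `Q` raises `level` by two. -/
theorem weightSeries_sub_Q {q : K} (hq : ∀ n : ℕ, 1 ≤ n → q ^ n ≠ 1) {f g : Vars4 → ℕ} {r : ℕ}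
    (hf : ∀ v : Vars4, f { v with Q := v.Q + 1 } = f v + r) (hg : ∀ v, g v = f v + v.Q) :
    weightSeries q f - weightSeries q g =
      zVar K ^ 2 * qConst q ^ r *
        (MvPowerSeries.X 0 * MvPowerSeries.X 1 * MvPowerSeries.X 2 * MvPowerSeries.X 3) *
        weightSeries q f := by
  obtain rfl : g = fun v => f v + v.Q := funext hg
  have h := weightSeries_sub (q := q) (s := fun v => { v with Q := v.Q + 1 }) (x := Q)
    (m := Finsupp.single 0 1 + Finsupp.single 1 1 + Finsupp.single 2 1 + Finsupp.single 3 1)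
    (e := 2) (f := f) (g := f) (r := r)
    (fun u v h => by
      cases u; cases v
      simpa using h)
    (fun v hv => ⟨{ v with Q := v.Q - 1 }, by
      ext <;> simp
      omega⟩)
    (fun v => by simp only [deg, Finsupp.single_add]; abel)
    (fun v => by simp only [level, tau]; ring)
    (fun v => by
      linear_combination (norm := skip) -q ^ (f v + r) * coef q { v with Q := 0 } *
        one_div_qPoch_succ hq v.Q
      simp only [coef, hf, qPoch_zero]
      ring)
  rw [h]
  simp only [MvPowerSeries.X, MvPowerSeries.monomial_mul_monomial, mul_one]

/-! ### The functional equation over `K[z]` -/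

/-- The generating series with the last factor of the summand and an additional weight `q ^ f`. -/
noncomputable def braceSeries (q : K) (f : Vars4 → ℕ) : MvPowerSeries (Fin 4) K[X] :=
  weightSeries q f - weightSeries q (fun v => f v + v.a)
    + (weightSeries q (fun v => f v + (v.a + v.bc + v.bd + v.Q))
      - weightSeries q (fun v => f v + (v.a + v.bc + v.bd + v.Q + v.b))
      + weightSeries q (fun v => f v + (v.a + v.bc + v.bd + v.Q + v.b + v.cd)))

/-- The generating series for `braceSeries` evaluated at `(A q, B, C, D)`, up to the factor
`1 + A q`, against the series for `(A, B, C, D)`. -/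
theorem one_add_mul_braceSeries {q : K} (hq : ∀ n : ℕ, 1 ≤ n → q ^ n ≠ 1) :
    (1 + qConst q * MvPowerSeries.X 0) *
        braceSeries q (fun v => v.a + v.ab + v.ac + v.ad + v.Q) =
      MvPowerSeries.X 0 * qConst q * weightSeries q level
        + (braceSeries q (fun _ => 0)
          - zVar K * MvPowerSeries.X 0 * weightSeries q (fun _ => 0)) := by
  -- the weights at the common denominator
  have a1 := weightSeries_sub_a hq (f := fun _ => 0) (g := fun v => 0 + v.a) (r := 0)
    (fun v => by simp) (fun v => by simp)
  have a2 := weightSeries_sub_b hq (f := fun v => 0 + (v.a + v.bc + v.bd + v.Q))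
    (g := fun v => 0 + (v.a + v.bc + v.bd + v.Q + v.b)) (r := 0)
    (fun v => by simp) (fun v => by ring)
  have a3 := weightSeries_sub_cd hq (f := fun v => 0 + (v.a + v.bc + v.bd + v.Q))
    (g := fun v => v.a + v.Q + v.bc + v.bd + v.cd) (r := 0)
    (fun v => by simp) (fun v => by ring)
  have a4 := weightSeries_sub_b hq (f := fun v => v.a + v.Q + v.bc + v.bd + v.cd)
    (g := fun v => 0 + (v.a + v.bc + v.bd + v.Q + v.b + v.cd)) (r := 0)
    (fun v => by simp) (fun v => by ring)
  have a5 := weightSeries_sub_ab hq (f := fun v => v.a + v.Q + v.bc + v.bd + v.cd)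
    (g := fun v => v.a + v.Q + v.bc + v.bd + v.cd + v.ab) (r := 0)
    (fun v => by simp) (fun v => by ring)
  have a6 := weightSeries_sub_ac hq (f := fun v => v.a + v.Q + v.bc + v.bd + v.cd + v.ab)
    (g := fun v => v.a + v.Q + v.bc + v.bd + v.cd + v.ab + v.ac) (r := 0)
    (fun v => by simp) (fun v => by ring)
  have a7 := weightSeries_sub_ad hq (f := fun v => v.a + v.Q + v.bc + v.bd + v.cd + v.ab + v.ac)
    (g := fun v => v.a + v.Q + v.bc + v.bd + v.cd + v.ab + v.ac + v.ad) (r := 0)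
    (fun v => by simp) (fun v => by ring)
  -- the weight `level`
  have b1 := weightSeries_sub_b hq
    (f := fun v => v.a + v.Q + v.bc + v.bd + v.cd + v.ab + v.ac + v.ad)
    (g := fun v => v.a + v.Q + v.bc + v.bd + v.cd + v.ab + v.ac + v.ad + v.b) (r := 0)
    (fun v => by simp) (fun v => by ring)
  have b2 := weightSeries_sub_c hq
    (f := fun v => v.a + v.Q + v.bc + v.bd + v.cd + v.ab + v.ac + v.ad + v.b)
    (g := fun v => v.a + v.Q + v.bc + v.bd + v.cd + v.ab + v.ac + v.ad + v.b + v.c) (r := 0)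
    (fun v => by simp) (fun v => by ring)
  have b3 := weightSeries_sub_d hq
    (f := fun v => v.a + v.Q + v.bc + v.bd + v.cd + v.ab + v.ac + v.ad + v.b + v.c)
    (g := fun v => v.a + v.Q + v.bc + v.bd + v.cd + v.ab + v.ac + v.ad + v.b + v.c + v.d)
    (r := 0) (fun v => by simp) (fun v => by ring)
  have b4 := weightSeries_sub_Q hq
    (f := fun v => v.a + v.Q + v.bc + v.bd + v.cd + v.ab + v.ac + v.ad + v.b + v.c + v.d)
    (g := level) (r := 1) (fun v => by ring) (fun v => by simp only [level, tau]; ring)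
  -- the weights with `A` replaced by `A q`
  have c1 := weightSeries_sub_bc hq (f := fun v => v.a + v.ab + v.ac + v.ad + v.Q)
    (g := fun v => v.a + v.ab + v.ac + v.ad + v.Q + v.bc) (r := 0)
    (fun v => by simp) (fun v => by ring)
  have c2 := weightSeries_sub_bd hq (f := fun v => v.a + v.ab + v.ac + v.ad + v.Q + v.bc)
    (g := fun v => v.a + v.ab + v.ac + v.ad + v.Q + v.bc + v.bd) (r := 0)
    (fun v => by simp) (fun v => by ring)
  have c3 := weightSeries_sub_cd hq (f := fun v => v.a + v.ab + v.ac + v.ad + v.Q + v.bc + v.bd)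
    (g := fun v => v.a + v.Q + v.bc + v.bd + v.cd + v.ab + v.ac + v.ad) (r := 0)
    (fun v => by simp) (fun v => by ring)
  have c4 := weightSeries_sub_a hq (f := fun v => v.a + v.ab + v.ac + v.ad + v.Q)
    (g := fun v => v.a + v.ab + v.ac + v.ad + v.Q + v.a) (r := 1)
    (fun v => by ring) (fun v => by ring)
  have c5 := weightSeries_sub_b hq
    (f := fun v => v.a + v.ab + v.ac + v.ad + v.Q + (v.a + v.bc + v.bd + v.Q))
    (g := fun v => v.a + v.ab + v.ac + v.ad + v.Q + (v.a + v.bc + v.bd + v.Q + v.b)) (r := 0)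
    (fun v => by simp) (fun v => by ring)
  have c6 := weightSeries_sub_cd hq
    (f := fun v => v.a + v.ab + v.ac + v.ad + v.Q + (v.a + v.bc + v.bd + v.Q))
    (g := fun v => v.a + v.ab + v.ac + v.ad + v.Q + (v.a + v.bc + v.bd + v.Q) + v.cd) (r := 0)
    (fun v => by simp) (fun v => by ring)
  have c7 := weightSeries_sub_b hq
    (f := fun v => v.a + v.ab + v.ac + v.ad + v.Q + (v.a + v.bc + v.bd + v.Q) + v.cd)
    (g := fun v => v.a + v.ab + v.ac + v.ad + v.Q + (v.a + v.bc + v.bd + v.Q + v.b + v.cd))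
    (r := 0) (fun v => by simp) (fun v => by ring)
  have c8 := weightSeries_sub_a hq
    (f := fun v => v.a + v.Q + v.bc + v.bd + v.cd + v.ab + v.ac + v.ad)
    (g := fun v => v.a + v.Q + v.bc + v.bd + v.cd + v.ab + v.ac + v.ad + v.a) (r := 1)
    (fun v => by ring) (fun v => by ring)
  have c9 := weightSeries_sub_Q hq
    (f := fun v => v.a + v.Q + v.bc + v.bd + v.cd + v.ab + v.ac + v.ad + v.a)
    (g := fun v => v.a + v.ab + v.ac + v.ad + v.Q + (v.a + v.bc + v.bd + v.Q) + v.cd) (r := 1)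
    (fun v => by ring) (fun v => by ring)
  simp only [braceSeries]
  -- Among the four series evaluated below, `p` takes the least shift of each denominator factor and
  -- the greatest shift of each numerator factor, so all four are polynomial multiples of `p`.
  generalize weightSeries q (fun v => v.a + v.Q + v.bc + v.bd + v.cd + v.ab + v.ac + v.ad) = p
    at *
  generalize zVar K = z at *
  generalize qConst q = κ at *
  generalize (MvPowerSeries.X 0 : MvPowerSeries (Fin 4) K[X]) = A at *
  generalize (MvPowerSeries.X 1 : MvPowerSeries (Fin 4) K[X]) = B at *
  generalize (MvPowerSeries.X 2 : MvPowerSeries (Fin 4) K[X]) = C at *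
  generalize (MvPowerSeries.X 3 : MvPowerSeries (Fin 4) K[X]) = D at *
  simp only [zero_add, pow_zero, pow_one, mul_one] at *
  have hY : weightSeries q (fun v => v.a + v.Q + v.bc + v.bd + v.cd) =
      (1 + z * κ * (A * B)) * (1 + z * κ * (A * C)) * (1 + z * κ * (A * D)) * p := by
    linear_combination a5 + (1 + z * κ * (A * B)) * a6 +
      (1 + z * κ * (A * B)) * (1 + z * κ * (A * C)) * a7
  have hT : weightSeries q level = (1 - z ^ 2 * κ * (A * B * C * D)) * (1 - z * D) * (1 - z * C) *
      (1 - z * B) * p := by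
    linear_combination -b4 - (1 - z ^ 2 * κ * (A * B * C * D)) * (b3 + (1 - z * D) * b2 +
      (1 - z * D) * (1 - z * C) * b1)
  have hI : weightSeries q (fun v => v.a + v.ab + v.ac + v.ad + v.Q) =
      (1 + z * (B * C)) * (1 + z * (B * D)) * (1 + z * (C * D)) * p := by
    linear_combination c1 + (1 + z * (B * C)) * c2 + (1 + z * (B * C)) * (1 + z * (B * D)) * c3
  have hJ : weightSeries q
      (fun v => v.a + v.ab + v.ac + v.ad + v.Q + (v.a + v.bc + v.bd + v.Q) + v.cd) =
      (1 - z ^ 2 * κ * (A * B * C * D)) * (1 - z * κ * A) * p := by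
    linear_combination -c9 - (1 - z ^ 2 * κ * (A * B * C * D)) * c8
  -- The last three series of a brace collapse, because `zB(1 + zCD) + (1 - zB) = 1 + z²BCD`; the
  -- first two of the unshifted brace differ by `zA` times the unweighted series, which the
  -- right-hand side subtracts. What is left is a polynomial identity in `z, κ, A, B, C, D` times
  -- `p`.
  linear_combination (1 + κ * A) * (c4 + (c5 + z * B * c6 - c7)) - (a2 + z * B * a3 - a4) - a1
    + (1 + κ * A) * (z * κ * A * hI + (1 + z ^ 2 * (B * C * D)) * hJ)
    - (1 + z ^ 2 * (B * C * D)) * hY - A * κ * hT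

/-! ### From powers of `z` back to triangular numbers -/

/-- The linear functional `z ^ t ↦ q ^ {T_t}`. -/
noncomputable def triEval (q : K) : K[X] →ₗ[K] K :=
  Polynomial.lsum fun t => q ^ tri t • LinearMap.id

theorem triEval_C_mul_X_pow (q c : K) (t : ℕ) : triEval q (C c * X ^ t) = q ^ tri t * c := by
  rw [C_mul_X_pow_eq_monomial, triEval, lsum_apply, sum_monomial_index _ _ (by simp)]
  simp

theorem triEval_coeff_weightSeries (q : K) (f : Vars4 → ℕ) (n : Fin 4 →₀ ℕ) :
    triEval q (MvPowerSeries.coeff n (weightSeries q f)) =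
      ∑ v ∈ (constraints_finite (n 0) (n 1) (n 2) (n 3)).toFinset,
        q ^ tri v.level * (q ^ f v * coef q v) := by
  rw [weightSeries, coeff_genSeries, map_sum]
  exact Finset.sum_congr rfl fun v _ => triEval_C_mul_X_pow _ _ _

/-- Because `T_{t+1} = T_t + t + 1`, an extra factor `z` amounts to the weight `q · q^t`. This makes
the two non-brace terms of the functional equation cancel. -/
theorem triEval_X_mul_coeff_weightSeries (q : K) (n : Fin 4 →₀ ℕ) :
    triEval q (X * MvPowerSeries.coeff n (weightSeries q fun _ => 0)) =
      triEval q (C q * MvPowerSeries.coeff n (weightSeries q level)) := by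
  simp only [weightSeries, coeff_genSeries, Finset.mul_sum, map_sum, weight]
  refine Finset.sum_congr rfl fun v _ => ?_
  rw [show (X : K[X]) * (C (q ^ 0 * coef q v) * X ^ v.level) =
      C (coef q v) * X ^ (v.level + 1) by rw [pow_zero, one_mul]; ring,
    ← mul_assoc, ← C_mul, triEval_C_mul_X_pow, triEval_C_mul_X_pow, tri_succ]
  ring

/-- Rests on `T_{τ+2Q} = T_τ + 2Qτ + 2Q² + Q`. -/
theorem expo_eq (v : Vars4) : v.expo = tri v.level + (tri v.ab + tri v.ac + tri v.ad +
    (tri v.bc - v.bc) + (tri v.bd - v.bd) + (tri v.cd - v.cd)) := by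
  have h1 := le_tri v.bc
  have h2 := le_tri v.bd
  have h3 := le_tri v.cd
  have h4 := two_mul_tri v.level
  have h5 := two_mul_tri v.tau
  have h6 := expo_cast v
  simp only [level] at h4 ⊢
  zify [h1, h2, h3]
  push_cast at h4
  linarith

theorem summand_eq (q : K) (v : Vars4) :
    v.summand q = q ^ tri v.level * coef q v * (1 - q ^ v.a +
      (q ^ (v.a + v.bc + v.bd + v.Q) - q ^ (v.a + v.bc + v.bd + v.Q + v.b)
        + q ^ (v.a + v.bc + v.bd + v.Q + v.b + v.cd))) := by
  have h : q ^ v.expo / (qPoch q q v.a * qPoch q q v.b * qPoch q q v.c * qPoch q q v.d *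
        qPoch q q v.ab * qPoch q q v.ac * qPoch q q v.ad *
        qPoch q q v.bc * qPoch q q v.bd * qPoch q q v.cd * qPoch q q v.Q) =
      q ^ tri v.level * coef q v := by
    rw [expo_eq, coef]
    simp only [pow_add, div_eq_mul_inv, mul_inv, one_mul]
    ring
  rw [summand, h]
  ring

theorem triEval_coeff_braceSeries (q : K) (f : Vars4 → ℕ) (n : Fin 4 →₀ ℕ) :
    triEval q (MvPowerSeries.coeff n (braceSeries q f)) =
      ∑ v ∈ (constraints_finite (n 0) (n 1) (n 2) (n 3)).toFinset, q ^ f v * v.summand q := by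
  simp only [braceSeries, map_add, map_sub, triEval_coeff_weightSeries]
  rw [← Finset.sum_sub_distrib, ← Finset.sum_sub_distrib, ← Finset.sum_add_distrib,
    ← Finset.sum_add_distrib]
  refine Finset.sum_congr rfl fun v _ => ?_
  rw [summand_eq]
  ring

end Vars4

/-! ### The recurrence in the first parameter -/

/-- This is the coefficient of `A^{i+1} B^j C^k D^l` in `F(A) = (1 + Aq) F(Aq)`. -/
theorem keySum_succ {K : Type*} [Field K] {q : K} (hq : ∀ n : ℕ, 1 ≤ n → q ^ n ≠ 1)
    (i j k l : ℕ) :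
    keySum q (i + 1) j k l =
      q ^ (i + 1) * keySum q (i + 1) j k l + q ^ (i + 1) * keySum q i j k l := by
  have key (n : Fin 4 →₀ ℕ) :
      Vars4.triEval q (MvPowerSeries.coeff n
        (Vars4.braceSeries q (fun v => v.a + v.ab + v.ac + v.ad + v.Q))) =
      q ^ n 0 * keySum q (n 0) (n 1) (n 2) (n 3) := by
    rw [Vars4.triEval_coeff_braceSeries, keySum, Finset.mul_sum]
    refine Finset.sum_congr rfl fun v hv => ?_
    rw [Set.Finite.mem_toFinset] at hv
    -- On the constraint set the weight is the exponent of `A`, so it realises the substitution `A ↦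
    -- Aq`.
    rw [← hv.1]
  have key0 (n : Fin 4 →₀ ℕ) :
      Vars4.triEval q (MvPowerSeries.coeff n (Vars4.braceSeries q (fun _ => 0))) =
      keySum q (n 0) (n 1) (n 2) (n 3) := by
    rw [Vars4.triEval_coeff_braceSeries, keySum]
    simp
  obtain ⟨n, h0, h1, h2, h3⟩ : ∃ n : Fin 4 →₀ ℕ, n 0 = i ∧ n 1 = j ∧ n 2 = k ∧ n 3 = l :=
    ⟨Finsupp.equivFunOnFinite.symm ![i, j, k, l], rfl, rfl, rfl, rfl⟩
  have h := congrArg (fun F => Vars4.triEval q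
    (MvPowerSeries.coeff (Finsupp.single 0 1 + n) F)) (Vars4.one_add_mul_braceSeries hq)
  have hX (F : MvPowerSeries (Fin 4) (Polynomial K)) :
      MvPowerSeries.coeff (Finsupp.single 0 1 + n) (MvPowerSeries.X 0 * F) =
        MvPowerSeries.coeff n F := by
    rw [MvPowerSeries.X, MvPowerSeries.coeff_add_monomial_mul, one_mul]
  have hC (c : K) (p : Polynomial K) :
      Vars4.triEval q (Polynomial.C c * p) = c * Vars4.triEval q p := by
    rw [← Polynomial.smul_eq_C_mul, map_smul, smul_eq_mul]
  rw [mul_comm (Vars4.qConst q), mul_comm (Vars4.zVar K), add_mul, one_mul, mul_assoc, mul_assoc,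
    mul_assoc] at h
  simp only [map_add, map_sub, hX, Vars4.qConst, Vars4.zVar, MvPowerSeries.coeff_C_mul,
    Vars4.triEval_X_mul_coeff_weightSeries, hC, key, key0] at h
  simp [h0, h1, h2, h3, add_comm 1 i] at h
  linear_combination -h

/-! ### Specialisation to three parameters -/

theorem tri_pred (n : ℕ) : tri (n - 1) = tri n - n := by
  cases n with
  | zero => rfl
  | succ n => rw [tri_succ, Nat.add_sub_cancel, Nat.add_sub_cancel]

/-- A zero parameter forces `Q` and each variable containing its letter to vanish. The remaining six
variables satisfy the three-parameter constraints; `e` and `p` are the relabellings. -/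
theorem keySum_eq_gollnitzSum {K : Type*} [Field K] {q : K} {i j k l x y z : ℕ}
    (e : Vars3 → Vars4) (p : Vars4 → Vars3)
    (he : ∀ u ∈ Vars3.constraints x y z, e u ∈ Vars4.constraints i j k l)
    (hp : ∀ v ∈ Vars4.constraints i j k l, p v ∈ Vars3.constraints x y z)
    (hpe : ∀ u, p (e u) = u) (hep : ∀ v ∈ Vars4.constraints i j k l, e (p v) = v)
    (hs : ∀ u, (e u).summand q = u.summand q) :
    keySum q i j k l = gollnitzSum q x y z := by
  symm
  refine Finset.sum_nbij' e p ?_ ?_ ?_ ?_ ?_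
  · simpa using he
  · simpa using hp
  · exact fun u _ => hpe u
  · simpa using hep
  · exact fun u _ => (hs u).symm

theorem keySum_zero_first {K : Type*} [Field K] (q : K) (x y z : ℕ) :
    keySum q 0 x y z = gollnitzSum q x y z := by
  refine keySum_eq_gollnitzSum (fun u => ⟨0, u.a, u.b, u.c, 0, 0, 0, u.ab, u.ac, u.bc, 0⟩)
    (fun v => ⟨v.b, v.c, v.d, v.bc, v.bd, v.cd⟩) ?_ ?_ (fun u => rfl) ?_ ?_
  · rintro u ⟨h1, h2, h3⟩
    refine ⟨?_, ?_, ?_, ?_⟩ <;> dsimp only <;> omega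
  · rintro v ⟨h0, h1, h2, h3⟩
    refine ⟨?_, ?_, ?_⟩ <;> dsimp only <;> omega
  · rintro v ⟨h0, h1, h2, h3⟩
    ext <;> dsimp only <;> omega
  · intro u
    have h1 := le_tri u.ab
    have h2 := le_tri u.ac
    have h3 := le_tri u.bc
    -- Here the exponent falls short by `u.ab + u.ac`. With `a = 0` the brace loses its first term
    -- and has the common factor `q^{bc+bd}`, which makes up the difference.
    have h : Vars4.expo ⟨0, u.a, u.b, u.c, 0, 0, 0, u.ab, u.ac, u.bc, 0⟩ + (u.ab + u.ac) =
        tri u.s + tri u.ab + tri u.ac + tri (u.bc - 1) := by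
      simp only [Vars4.expo, Vars4.tau, Vars3.s, tri_pred, tri_zero]
      simp only [zero_add, add_zero, mul_zero, zero_mul, Nat.zero_sub]
      omega
    rw [Vars3.summand, Vars4.summand, ← h]
    simp only [qPoch_zero, pow_zero, one_mul, mul_one, zero_add, add_zero, sub_self, pow_add]
    ring

theorem keySum_zero_second {K : Type*} [Field K] (q : K) (x y z : ℕ) :
    keySum q x 0 y z = gollnitzSum q x y z := by
  refine keySum_eq_gollnitzSum (fun u => ⟨u.a, 0, u.b, u.c, 0, u.ab, u.ac, 0, 0, u.bc, 0⟩)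
    (fun v => ⟨v.a, v.c, v.d, v.ac, v.ad, v.cd⟩) ?_ ?_ (fun u => rfl) ?_ ?_
  · rintro u ⟨h1, h2, h3⟩
    refine ⟨?_, ?_, ?_, ?_⟩ <;> dsimp only <;> omega
  · rintro v ⟨h0, h1, h2, h3⟩
    refine ⟨?_, ?_, ?_⟩ <;> dsimp only <;> omega
  · rintro v ⟨h0, h1, h2, h3⟩
    ext <;> dsimp only <;> omega
  · intro u
    have h3 := le_tri u.bc
    have h : Vars4.expo ⟨u.a, 0, u.b, u.c, 0, u.ab, u.ac, 0, 0, u.bc, 0⟩ =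
        tri u.s + tri u.ab + tri u.ac + tri (u.bc - 1) := by
      simp only [Vars4.expo, Vars4.tau, Vars3.s, tri_pred, tri_zero]
      simp only [add_zero, mul_zero, zero_mul, Nat.zero_sub]
      omega
    rw [Vars3.summand, Vars4.summand, ← h]
    simp only [qPoch_zero, pow_zero, mul_one, add_zero, sub_self, pow_add]
    ring

theorem keySum_zero_third {K : Type*} [Field K] (q : K) (x y z : ℕ) :
    keySum q x y 0 z = gollnitzSum q x y z := by
  refine keySum_eq_gollnitzSum (fun u => ⟨u.a, u.b, 0, u.c, u.ab, 0, u.ac, 0, u.bc, 0, 0⟩)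
    (fun v => ⟨v.a, v.b, v.d, v.ab, v.ad, v.bd⟩) ?_ ?_ (fun u => rfl) ?_ ?_
  · rintro u ⟨h1, h2, h3⟩
    refine ⟨?_, ?_, ?_, ?_⟩ <;> dsimp only <;> omega
  · rintro v ⟨h0, h1, h2, h3⟩
    refine ⟨?_, ?_, ?_⟩ <;> dsimp only <;> omega
  · rintro v ⟨h0, h1, h2, h3⟩
    ext <;> dsimp only <;> omega
  · intro u
    have h3 := le_tri u.bc
    have h : Vars4.expo ⟨u.a, u.b, 0, u.c, u.ab, 0, u.ac, 0, u.bc, 0, 0⟩ =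
        tri u.s + tri u.ab + tri u.ac + tri (u.bc - 1) := by
      simp only [Vars4.expo, Vars4.tau, Vars3.s, tri_pred, tri_zero]
      simp only [add_zero, mul_zero, zero_mul, Nat.zero_sub]
      omega
    rw [Vars3.summand, Vars4.summand, ← h]
    -- The terms `±q^{a+bd+b}` of the brace cancel, leaving the three-parameter factor.
    simp only [qPoch_zero, mul_one, add_zero, pow_add]
    ring

theorem keySum_zero_fourth {K : Type*} [Field K] (q : K) (x y z : ℕ) :
    keySum q x y z 0 = gollnitzSum q x y z := by
  refine keySum_eq_gollnitzSum (fun u => ⟨u.a, u.b, u.c, 0, u.ab, u.ac, 0, u.bc, 0, 0, 0⟩)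
    (fun v => ⟨v.a, v.b, v.c, v.ab, v.ac, v.bc⟩) ?_ ?_ (fun u => rfl) ?_ ?_
  · rintro u ⟨h1, h2, h3⟩
    refine ⟨?_, ?_, ?_, ?_⟩ <;> dsimp only <;> omega
  · rintro v ⟨h0, h1, h2, h3⟩
    refine ⟨?_, ?_, ?_⟩ <;> dsimp only <;> omega
  · rintro v ⟨h0, h1, h2, h3⟩
    ext <;> dsimp only <;> omega
  · intro u
    have h3 := le_tri u.bc
    have h : Vars4.expo ⟨u.a, u.b, u.c, 0, u.ab, u.ac, 0, u.bc, 0, 0, 0⟩ =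
        tri u.s + tri u.ab + tri u.ac + tri (u.bc - 1) := by
      simp only [Vars4.expo, Vars4.tau, Vars3.s, tri_pred, tri_zero]
      simp only [add_zero, mul_zero, zero_mul, Nat.zero_sub]
      omega
    rw [Vars3.summand, Vars4.summand, ← h]
    simp only [qPoch_zero, mul_one, add_zero, pow_add]
    ring

/-! ### The product formula -/

theorem keySum_zero {K : Type*} [Field K] (q : K) : keySum q 0 0 0 0 = 1 := by
  have h : (Vars4.constraints_finite 0 0 0 0).toFinset = {⟨0, 0, 0, 0, 0, 0, 0, 0, 0, 0, 0⟩} := by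
    ext v
    rw [Set.Finite.mem_toFinset, Finset.mem_singleton]
    constructor
    · rintro ⟨h1, h2, h3, h4⟩
      ext <;> dsimp only <;> omega
    · rintro rfl
      simp [Vars4.constraints]
  rw [keySum, h, Finset.sum_singleton]
  simp [Vars4.summand, Vars4.expo, Vars4.tau, tri_zero, qPoch_zero]

/-- Descent on `i` reaches `S(0,j,k,l)`, which equals `S(j,k,l,0)` since both are the same
three-parameter sum. The rotation puts the next parameter first. -/
theorem keySum_eq_mul {K : Type*} [Field K] {q : K} (hq : ∀ n : ℕ, 1 ≤ n → q ^ n ≠ 1)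
    (i j k l : ℕ) :
    keySum q i j k l = q ^ tri i / qPoch q q i * keySum q j k l 0 := by
  induction i with
  | zero => simp [tri_zero, qPoch_zero, keySum_zero_first, keySum_zero_fourth]
  | succ i ih =>
    have h1 := one_sub_pow_ne_zero hq i
    have h2 := qPoch_self_ne_zero hq i
    have h3 := keySum_succ hq i j k l
    rw [ih] at h3
    rw [tri_succ, qPoch_self_succ]
    apply mul_left_cancel₀ h1
    field_simp at h3 ⊢
    rw [pow_add]
    linear_combination h3

theorem keySum_eq_keyRhs {K : Type*} [Field K] {q : K} (hq : ∀ n : ℕ, 1 ≤ n → q ^ n ≠ 1)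
    (i j k l : ℕ) : keySum q i j k l = keyRhs q i j k l := by
  rw [keySum_eq_mul hq, keySum_eq_mul hq, keySum_eq_mul hq, keySum_eq_mul hq, keySum_zero, keyRhs]
  simp only [pow_add, div_eq_mul_inv, mul_inv]
  ring

/-! ### Euler's identity -/

theorem pow_ne_one_of_norm_lt_one {q : ℂ} (hq : ‖q‖ < 1) (n : ℕ) (hn : 1 ≤ n) : q ^ n ≠ 1 := by
  intro h
  have h1 : ‖q‖ ^ n < 1 := pow_lt_one₀ (norm_nonneg q) hq (by omega)
  rw [← norm_pow, h, norm_one] at h1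
  exact lt_irrefl _ h1

theorem euler_term_succ {q : ℂ} (hq : ‖q‖ < 1) (x : ℂ) (n : ℕ) :
    (1 - q ^ (n + 1)) * (x ^ (n + 1) * (q ^ tri (n + 1) / qPoch q q (n + 1))) =
      x * q ^ (n + 1) * (x ^ n * (q ^ tri n / qPoch q q n)) := by
  have h1 := one_sub_pow_ne_zero (pow_ne_one_of_norm_lt_one hq) n
  have h2 := qPoch_self_ne_zero (pow_ne_one_of_norm_lt_one hq) n
  rw [qPoch_self_succ, tri_succ]
  field_simp
  ring

/-- Ratio test: the quotient of consecutive terms is `x q^{n+1} / (1 - q^{n+1})`, which tends to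
`0`. -/
theorem summable_norm_euler {q : ℂ} (hq : ‖q‖ < 1) (x : ℂ) :
    Summable fun n : ℕ => ‖x ^ n * (q ^ tri n / qPoch q q n)‖ := by
  have h1 : Filter.Tendsto (fun n : ℕ => q ^ (n + 1)) Filter.atTop (nhds 0) :=
    (Filter.tendsto_add_atTop_iff_nat 1).2 (tendsto_pow_atTop_nhds_zero_of_norm_lt_one hq)
  have h2 : Filter.Tendsto (fun n : ℕ => ‖x * q ^ (n + 1) / (1 - q ^ (n + 1))‖)
      Filter.atTop (nhds 0) := by
    have := ((h1.const_mul x).div (tendsto_const_nhds.sub h1) (by norm_num : (1 : ℂ) - 0 ≠ 0)).norm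
    simpa using this
  refine summable_of_ratio_norm_eventually_le (r := 1 / 2) (by norm_num) ?_
  filter_upwards [h2.eventually_le_const (by norm_num : (0 : ℝ) < 1 / 2)] with n hn
  have h3 := one_sub_pow_ne_zero (pow_ne_one_of_norm_lt_one hq) n
  have h4 : x ^ (n + 1) * (q ^ tri (n + 1) / qPoch q q (n + 1)) =
      x * q ^ (n + 1) / (1 - q ^ (n + 1)) * (x ^ n * (q ^ tri n / qPoch q q n)) := by
    rw [div_mul_eq_mul_div, ← euler_term_succ hq, mul_div_cancel_left₀ _ h3]
  rw [norm_norm, norm_norm, h4, norm_mul]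
  exact mul_le_mul_of_nonneg_right hn (norm_nonneg _)

theorem tsum_euler_eq {q : ℂ} (hq : ‖q‖ < 1) (x : ℂ) :
    ∑' n : ℕ, x ^ n * (q ^ tri n / qPoch q q n) =
      (1 + x * q) * ∑' n : ℕ, (x * q) ^ n * (q ^ tri n / qPoch q q n) := by
  have h1 := (summable_norm_euler hq x).of_norm
  have h2 := (summable_norm_euler hq (x * q)).of_norm
  have h3 : ∑' n : ℕ, (x ^ n * (q ^ tri n / qPoch q q n)
      - (x * q) ^ n * (q ^ tri n / qPoch q q n)) =
      x * q * ∑' n : ℕ, (x * q) ^ n * (q ^ tri n / qPoch q q n) := by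
    rw [(h1.sub h2).tsum_eq_zero_add, ← tsum_mul_left]
    simp only [pow_zero, sub_self, zero_add]
    refine tsum_congr fun n => ?_
    have := euler_term_succ hq x n
    rw [mul_pow, mul_pow]
    linear_combination this
  rw [h1.tsum_sub h2] at h3
  linear_combination h3

theorem tsum_euler_eq_qPoch_mul {q : ℂ} (hq : ‖q‖ < 1) (x : ℂ) (N : ℕ) :
    ∑' n : ℕ, x ^ n * (q ^ tri n / qPoch q q n) =
      qPoch (-(x * q)) q N * ∑' n : ℕ, (x * q ^ N) ^ n * (q ^ tri n / qPoch q q n) := by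
  induction N with
  | zero => simp [qPoch_zero]
  | succ N ih =>
    rw [ih, tsum_euler_eq hq (x * q ^ N), qPoch_succ, mul_assoc x, ← pow_succ]
    ring

/-- Iterating `E(x) = (1 + xq) E(xq)` gives `E(x) = (-xq)_N E(xq^N)`. As `N → ∞`, the last factor
tends to `E(0) = 1`. -/
theorem hasSum_euler {q : ℂ} (hq : ‖q‖ < 1) (x : ℂ) :
    HasSum (fun n : ℕ => x ^ n * (q ^ tri n / qPoch q q n)) (qPochInf (-(x * q)) q) := by
  have hs := summable_norm_euler hq x
  suffices h : ∑' n : ℕ, x ^ n * (q ^ tri n / qPoch q q n) = qPochInf (-(x * q)) q from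
    h ▸ hs.of_norm.hasSum
  have hlim : Filter.Tendsto
      (fun N : ℕ => ∑' n : ℕ, (x * q ^ N) ^ n * (q ^ tri n / qPoch q q n)) Filter.atTop
      (nhds (∑' n : ℕ, (x * 0) ^ n * (q ^ tri n / qPoch q q n))) := by
    -- The series at `x` itself dominates, since `|x q^N| ≤ |x|`.
    refine tendsto_tsum_of_dominated_convergence hs (fun n => ?_) (Filter.Eventually.of_forall ?_)
    · exact (((tendsto_pow_atTop_nhds_zero_of_norm_lt_one hq).const_mul x).pow n).mul_const _
    · intro N n
      rw [norm_mul, norm_mul (x ^ n)]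
      refine mul_le_mul_of_nonneg_right ?_ (norm_nonneg _)
      rw [norm_pow, norm_pow, norm_mul, norm_pow]
      refine pow_le_pow_left₀ (by positivity) ?_ n
      exact mul_le_of_le_one_right (norm_nonneg x) (pow_le_one₀ (norm_nonneg q) hq.le)
  have h0 : ∑' n : ℕ, (x * 0) ^ n * (q ^ tri n / qPoch q q n) = 1 := by
    rw [tsum_eq_single 0 fun n hn => by simp [hn]]
    simp [tri_zero, qPoch_zero]
  rw [h0] at hlim
  have h := (tendsto_qPoch (-(x * q)) q hq).mul hlim
  simp only [← tsum_euler_eq_qPoch_mul hq, mul_one] at h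
  exact tendsto_nhds_unique tendsto_const_nhds h

/-- By the product formula the summand splits into four Euler series, and absolute convergence
justifies multiplying them. In `ℂ`, `HasSum` already entails absolute convergence. -/
theorem hasSum_keySum {q : ℂ} (hq : ‖q‖ < 1) (A B C D : ℂ) :
    HasSum (fun n : ℕ × ℕ × ℕ × ℕ =>
        A ^ n.1 * B ^ n.2.1 * C ^ n.2.2.1 * D ^ n.2.2.2 * keySum q n.1 n.2.1 n.2.2.1 n.2.2.2)
      (qPochInf (-(A * q)) q * qPochInf (-(B * q)) q *
        qPochInf (-(C * q)) q * qPochInf (-(D * q)) q) := by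
  have nA := summable_norm_euler hq A
  have nB := summable_norm_euler hq B
  have nC := summable_norm_euler hq C
  have nD := summable_norm_euler hq D
  have nCD := nC.mul_norm nD
  have nBCD := nB.mul_norm nCD
  have h := (hasSum_euler hq A).mul ((hasSum_euler hq B).mul
    ((hasSum_euler hq C).mul (hasSum_euler hq D) nCD.of_norm) nBCD.of_norm)
    (nA.mul_norm nBCD).of_norm
  rw [← mul_assoc, ← mul_assoc] at h
  refine (congrArg (fun F => HasSum F _) (funext fun n => ?_)).mpr h
  rw [keySum_eq_keyRhs (pow_ne_one_of_norm_lt_one hq), keyRhs]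
  simp only [pow_add, div_eq_mul_inv, mul_inv]
  ring

/-! ### Assembly of the four statements -/

theorem mainTheorem1 :
    -- the constrained sum is a finite sevenfold sum
    (∀ i j k l : ℕ, (Vars4.constraints i j k l).Finite ∧
      Set.BijOn Vars4.free (Vars4.constraints i j k l)
        {(ab, ac, ad, bc, bd, cd, Q) : ℕ × ℕ × ℕ × ℕ × ℕ × ℕ × ℕ |
          ab + ac + ad + Q ≤ i ∧ ab + bc + bd + Q ≤ j ∧
          ac + bc + cd + Q ≤ k ∧ ad + bd + cd + Q ≤ l}) ∧
    -- the key identity, coefficient form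
    (∀ (K : Type*) [Field K] (q : K), (∀ n : ℕ, 1 ≤ n → q ^ n ≠ 1) →
      ∀ i j k l : ℕ, keySum q i j k l = keyRhs q i j k l) ∧
    -- the key identity, generating function form
    (∀ q : ℂ, ‖q‖ < 1 → ∀ A B C D : ℂ,
      HasSum (fun n : ℕ × ℕ × ℕ × ℕ =>
          A ^ n.1 * B ^ n.2.1 * C ^ n.2.2.1 * D ^ n.2.2.2 *
            keySum q n.1 n.2.1 n.2.2.1 n.2.2.2)
        (qPochInf (-(A * q)) q * qPochInf (-(B * q)) q *
          qPochInf (-(C * q)) q * qPochInf (-(D * q)) q)) ∧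
    -- setting any one parameter to zero gives the three-parameter identity
    (∀ (K : Type*) [Field K] (q : K), (∀ n : ℕ, 1 ≤ n → q ^ n ≠ 1) →
      ∀ x y z : ℕ,
        (keySum q 0 x y z = gollnitzSum q x y z ∧ keyRhs q 0 x y z = gollnitzRhs q x y z) ∧
        (keySum q x 0 y z = gollnitzSum q x y z ∧ keyRhs q x 0 y z = gollnitzRhs q x y z) ∧
        (keySum q x y 0 z = gollnitzSum q x y z ∧ keyRhs q x y 0 z = gollnitzRhs q x y z) ∧
        (keySum q x y z 0 = gollnitzSum q x y z ∧ keyRhs q x y z 0 = gollnitzRhs q x y z) ∧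
        gollnitzSum q x y z = gollnitzRhs q x y z) := by
  refine ⟨fun i j k l => ⟨Vars4.constraints_finite i j k l, ?_, Vars4.free_injOn i j k l, ?_⟩,
    fun K _ q hq => keySum_eq_keyRhs hq, fun q hq => hasSum_keySum hq, fun K _ q hq x y z => ?_⟩
  · rintro v ⟨h1, h2, h3, h4⟩
    refine ⟨?_, ?_, ?_, ?_⟩ <;> omega
  · rintro ⟨ab, ac, ad, bc, bd, cd, Q⟩ ⟨h1, h2, h3, h4⟩
    -- The constraints are solved for `a, b, c, d`; the four inequalities rule out truncation.
    refine ⟨⟨i - (ab + ac + ad + Q), j - (ab + bc + bd + Q), k - (ac + bc + cd + Q),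
      l - (ad + bd + cd + Q), ab, ac, ad, bc, bd, cd, Q⟩, ?_, rfl⟩
    refine ⟨?_, ?_, ?_, ?_⟩ <;> dsimp only <;> omega
  have h1 : keyRhs q 0 x y z = gollnitzRhs q x y z := by
    simp [keyRhs, gollnitzRhs, tri_zero, qPoch_zero]
  have h2 : keyRhs q x 0 y z = gollnitzRhs q x y z := by
    simp [keyRhs, gollnitzRhs, tri_zero, qPoch_zero]
  have h3 : keyRhs q x y 0 z = gollnitzRhs q x y z := by
    simp [keyRhs, gollnitzRhs, tri_zero, qPoch_zero]
  have h4 : keyRhs q x y z 0 = gollnitzRhs q x y z := by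
    simp [keyRhs, gollnitzRhs, tri_zero, qPoch_zero]
  exact ⟨⟨keySum_zero_first q x y z, h1⟩, ⟨keySum_zero_second q x y z, h2⟩,
    ⟨keySum_zero_third q x y z, h3⟩, ⟨keySum_zero_fourth q x y z, h4⟩,
    by rw [← keySum_zero_fourth, keySum_eq_keyRhs hq, h4]⟩
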